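/- Let $\mathbb{T}$ be the unit circle with normalized Lebesgue measure $m$, and let $H^\infty\subset L^\infty(\mathbb{T},m)$ be the space of boundary functions of bounded analytic functions on the unit disc, i.e. of those $f\in L^\infty(\mathbb{T},m)$ whose Fourier coefficients $\hat f(n)$, $n<0$, all vanish. A function $f\in H^\infty$ is called inner if $|f|=1$ $m$-a.e. on $\mathbb{T}$ (unimodular constants are thus inner). For a measurable function $f$ on $\mathbb{T}$ put $f^{\#}(z)=\overline{f(\bar z)}$. Functions are identified if they agree $m$-a.e. Let $\alpha$ be a nonconstant inner function. Then $$\{\beta:\ \beta \text{ is inner},\ \alpha\alpha^{\#}=\beta\beta^{\#}\}=\{\lambda\,uv^{\#}:\ u,v\text{ are inner},\ \alpha=uv,\ \lambda\in\mathbb{T}\}.$$ -/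

import Mathlib

open MeasureTheory
open scoped ENNReal

noncomputable section

/-- The normalized Lebesgue measure `m` on the unit circle `𝕋`. The circle is parametrized by
`t ∈ ℝ/ℤ` through `z = exp (2 π i t)`, so that `z ^ n` is `fourier n t` and the complex conjugate
of `z` corresponds to `-t`. -/
abbrev circleMeasure : Measure UnitAddCircle := AddCircle.haarAddCircle

/-- Measurable complex functions on the circle modulo equality `m`-almost everywhere, with pointwise
operations; `L^p(𝕋, m)` is the additive subgroup `Lp ℂ p circleMeasure` of it. -/
abbrev CircleFun : Type := UnitAddCircle →ₘ[circleMeasure] ℂ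

/-- The function `f^#`, given by `f^#(z) = conj (f (conj z))`. -/
def CircleFun.sharp (f : CircleFun) : CircleFun :=
  (star f).compMeasurePreserving (fun t : UnitAddCircle => -t)
    (Measure.measurePreserving_neg circleMeasure)

/-- The Hardy space `H^∞`, as a subspace of `L^∞(𝕋, m)`: the essentially bounded functions whose
Fourier coefficients of negative index vanish. These are exactly the boundary functions of the
bounded analytic functions on the unit disc. -/
def hardyInfty : Set CircleFun :=
  {f | f ∈ Lp ℂ ∞ circleMeasure ∧ ∀ n : ℤ, n < 0 → fourierCoeff f n = 0}

/-- Inner functions: functions in `H^∞` of modulus `1` almost everywhere on the circle. -/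
def IsInner (f : CircleFun) : Prop :=
  f ∈ hardyInfty ∧ ∀ᵐ t ∂circleMeasure, ‖f t‖ = 1

end

/-!
The unimodular functions on the circle form a group under multiplication with inverse `star`, and an
inner function `x` divides an inner function `y` when `star x * y` is inner.

If `β = λ u v^#` with `α = u v`, then `β β^# = u v^# u^# v = α α^#`, and `β` is inner because
products of inner functions are inner (`IsInner.mul`) and `#` preserves inner functions
(`IsInner.sharp`).

For the converse, let `u` be the greatest common divisor of `α` and `β`, and write `α = u v`,
`β = u w`. Then `v v^# = w w^#`. Thus `v` divides `w w^#` and is coprime to `w`, so it divides `w^#`;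
by symmetry `w` divides `v^#`, hence `w^#` divides `v`. Consequently `w^#` is a constant multiple of
`v` (`eq_smul_one_of_isInner_star`), which gives `β = λ u v^#`.

The existence of the greatest common divisor, in a form that contains Euclid's lemma, is
`exists_isInner_gcd`. It is the argument of Beurling's theorem, applied to the closed
shift-invariant subspace of `H²` generated by `α` and `β`. That the function produced there is unimodular is
`isUnimodular_of_fourierCoeff_star_mul_self`, a consequence of the fact that a finite measure
on the circle is determined by its Fourier coefficients.
-/

open scoped ComplexConjugate

namespace CircleFun

/-! ### The algebra of circle functions and the operation `#` -/

theorem star_mul_eq (f g : CircleFun) : star (f * g) = star f * star g := by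
  apply AEEqFun.ext
  filter_upwards [AEEqFun.coeFn_star (f * g), AEEqFun.coeFn_mul f g,
    AEEqFun.coeFn_mul (star f) (star g), AEEqFun.coeFn_star f, AEEqFun.coeFn_star g]
    with t h1 h2 h3 h4 h5
  simp [h1, h2, h3, h4, h5]

theorem coeFn_sharp (f : CircleFun) : f.sharp =ᵐ[circleMeasure] fun t => conj (f (-t)) := by
  have hneg := Measure.measurePreserving_neg circleMeasure
  refine (AEEqFun.coeFn_compMeasurePreserving (star f) hneg).trans ?_
  filter_upwards [hneg.quasiMeasurePreserving.ae (AEEqFun.coeFn_star f)] with t ht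
  simpa using ht

theorem sharp_mul (f g : CircleFun) : (f * g).sharp = f.sharp * g.sharp := by
  have hneg := Measure.measurePreserving_neg circleMeasure
  apply AEEqFun.ext
  filter_upwards [coeFn_sharp (f * g), hneg.quasiMeasurePreserving.ae (AEEqFun.coeFn_mul f g),
    AEEqFun.coeFn_mul f.sharp g.sharp, coeFn_sharp f, coeFn_sharp g] with t h1 h2 h3 h4 h5
  simp [h1, h2, h3, h4, h5]

theorem sharp_sharp (f : CircleFun) : f.sharp.sharp = f := by
  have hneg := Measure.measurePreserving_neg circleMeasure
  apply AEEqFun.ext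
  filter_upwards [coeFn_sharp f.sharp, hneg.quasiMeasurePreserving.ae (coeFn_sharp f)] with t h1 h2
  simp [h1, h2]

theorem sharp_star (f : CircleFun) : (star f).sharp = star f.sharp := by
  have hneg := Measure.measurePreserving_neg circleMeasure
  apply AEEqFun.ext
  filter_upwards [coeFn_sharp (star f), hneg.quasiMeasurePreserving.ae (AEEqFun.coeFn_star f),
    AEEqFun.coeFn_star f.sharp, coeFn_sharp f] with t h1 h2 h3 h4
  simp [h1, h2, h3, h4]

theorem sharp_smul (c : ℂ) (f : CircleFun) : (c • f).sharp = conj c • f.sharp := by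
  have hneg := Measure.measurePreserving_neg circleMeasure
  apply AEEqFun.ext
  filter_upwards [coeFn_sharp (c • f), hneg.quasiMeasurePreserving.ae (AEEqFun.coeFn_smul c f),
    AEEqFun.coeFn_smul (conj c) f.sharp, coeFn_sharp f] with t h1 h2 h3 h4
  simp [h1, h2, h3, h4]

theorem smul_mul_eq (c : ℂ) (f g : CircleFun) : c • f * g = c • (f * g) := by
  apply AEEqFun.ext
  filter_upwards [AEEqFun.coeFn_mul (c • f) g, AEEqFun.coeFn_smul c f,
    AEEqFun.coeFn_smul c (f * g), AEEqFun.coeFn_mul f g] with t h1 h2 h3 h4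
  simp [h1, h2, h3, h4, mul_assoc]

theorem mul_smul_eq (c : ℂ) (f g : CircleFun) : f * c • g = c • (f * g) := by
  rw [mul_comm, smul_mul_eq, mul_comm]

/-! ### Monomials and Fourier coefficients -/

/-- The monomial `z ^ n` as a function on the circle modulo null sets. -/
noncomputable def monomial (n : ℤ) : CircleFun :=
  AEEqFun.mk (fourier n) (fourier n).continuous.aestronglyMeasurable

theorem coeFn_monomial (n : ℤ) : monomial n =ᵐ[circleMeasure] fourier n :=
  AEEqFun.coeFn_mk _ _

theorem star_monomial (n : ℤ) : star (monomial n) = monomial (-n) := by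
  apply AEEqFun.ext
  filter_upwards [AEEqFun.coeFn_star (monomial n), coeFn_monomial n, coeFn_monomial (-n)]
    with t h1 h2 h3
  simp only [h1, h2, h3, Pi.star_apply, fourier_neg, RCLike.star_def]

theorem monomial_zero : monomial 0 = 1 := by
  apply AEEqFun.ext
  filter_upwards [coeFn_monomial 0,
    AEEqFun.coeFn_one (α := UnitAddCircle) (μ := circleMeasure) (β := ℂ)] with t h1 h2
  simp [h1, h2]

theorem monomial_mul_monomial (m n : ℤ) : monomial m * monomial n = monomial (m + n) := by
  apply AEEqFun.ext
  filter_upwards [AEEqFun.coeFn_mul (monomial m) (monomial n), coeFn_monomial m, coeFn_monomial n,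
    coeFn_monomial (m + n)] with t h1 h2 h3 h4
  rw [h1, Pi.mul_apply, h2, h3, h4, fourier_add]

theorem fourierCoeff_monomial_mul (k : ℤ) (f : CircleFun) (n : ℤ) :
    fourierCoeff (monomial k * f : CircleFun) n = fourierCoeff f (n - k) := by
  apply integral_congr_ae
  filter_upwards [AEEqFun.coeFn_mul (monomial k) f, coeFn_monomial k] with t h1 h2
  rw [h1, Pi.mul_apply, h2, neg_sub, sub_eq_add_neg, fourier_add]
  simp only [smul_eq_mul]
  ring

theorem fourierCoeff_star (f : CircleFun) (n : ℤ) :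
    fourierCoeff (star f : CircleFun) n = conj (fourierCoeff f (-n)) := by
  unfold fourierCoeff
  rw [← integral_conj]
  apply integral_congr_ae
  filter_upwards [AEEqFun.coeFn_star f] with t h1
  rw [h1]
  simp

theorem fourierCoeff_sharp (f : CircleFun) (n : ℤ) :
    fourierCoeff f.sharp n = conj (fourierCoeff f n) := by
  unfold fourierCoeff
  rw [← integral_conj, ← integral_neg_eq_self]
  apply integral_congr_ae
  have hneg := Measure.measurePreserving_neg circleMeasure
  filter_upwards [hneg.quasiMeasurePreserving.ae (coeFn_sharp f)] with t h1
  rw [h1, neg_neg]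
  simp [fourier_apply]

/-! ### Unimodular, analytic and inner functions -/

/-- A function on the circle is unimodular if it has modulus `1` almost everywhere. -/
def IsUnimodular (f : CircleFun) : Prop :=
  ∀ᵐ t ∂circleMeasure, ‖f t‖ = 1

theorem isUnimodular_monomial (n : ℤ) : IsUnimodular (monomial n) := by
  filter_upwards [coeFn_monomial n] with t h1
  rw [h1, fourier_apply, Circle.norm_coe]

namespace IsUnimodular

variable {f g : CircleFun}

theorem mul (hf : IsUnimodular f) (hg : IsUnimodular g) : IsUnimodular (f * g) := by
  filter_upwards [hf, hg, AEEqFun.coeFn_mul f g] with t h1 h2 h3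
  simp [h1, h2, h3]

theorem star (hf : IsUnimodular f) : IsUnimodular (star f) := by
  filter_upwards [hf, AEEqFun.coeFn_star f] with t h1 h2
  simp [h1, h2]

theorem sharp (hf : IsUnimodular f) : IsUnimodular f.sharp := by
  have hneg := Measure.measurePreserving_neg circleMeasure
  filter_upwards [hneg.quasiMeasurePreserving.ae hf, coeFn_sharp f] with t h1 h2
  simp [h1, h2]

theorem mul_star_self (hf : IsUnimodular f) : f * Star.star f = 1 := by
  apply AEEqFun.ext
  filter_upwards [hf, AEEqFun.coeFn_mul f (Star.star f), AEEqFun.coeFn_star f,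
    AEEqFun.coeFn_one (α := UnitAddCircle) (μ := circleMeasure) (β := ℂ)] with t h1 h2 h3 h4
  simp [h2, h3, h4, Complex.mul_conj, Complex.normSq_eq_norm_sq, h1]

theorem mul_mem_Lp {p : ℝ≥0∞} (hf : IsUnimodular f) (hg : g ∈ Lp ℂ p circleMeasure) :
    f * g ∈ Lp ℂ p circleMeasure := by
  refine Lp.mem_Lp_of_ae_le (g := ⟨g, hg⟩) ?_
  filter_upwards [hf, AEEqFun.coeFn_mul f g] with t h1 h2
  simp [h1, h2]

theorem mem_Lp {p : ℝ≥0∞} (hf : IsUnimodular f) : f ∈ Lp ℂ p circleMeasure := by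
  rw [Lp.mem_Lp_iff_memLp]
  exact MemLp.of_bound f.aestronglyMeasurable 1 (hf.mono fun t h => h.le)

end IsUnimodular

/-- The functions whose Fourier coefficients of negative index vanish. -/
def IsAnalytic (f : CircleFun) : Prop :=
  ∀ n : ℤ, n < 0 → fourierCoeff f n = 0

theorem isInner_iff {f : CircleFun} : IsInner f ↔ IsUnimodular f ∧ IsAnalytic f :=
  ⟨fun h => ⟨h.2, h.1.2⟩, fun h => ⟨⟨h.1.mem_Lp, h.2⟩, h.1⟩⟩

theorem inner_eq_fourierCoeff (f g : Lp ℂ 2 circleMeasure) :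
    inner ℂ f g = fourierCoeff (star (f : CircleFun) * (g : CircleFun) : CircleFun) 0 := by
  rw [L2.inner_def]
  apply integral_congr_ae
  filter_upwards [AEEqFun.coeFn_mul (star (f : CircleFun)) g, AEEqFun.coeFn_star (f : CircleFun)]
    with t h1 h2
  rw [h1, Pi.mul_apply, h2]
  simp [mul_comm]

/-- The monomial `z ^ n` as an element of `L²`. -/
noncomputable def monomialL2 (n : ℤ) : Lp ℂ 2 circleMeasure :=
  ⟨monomial n, (isUnimodular_monomial n).mem_Lp⟩

theorem monomialL2_eq (n : ℤ) : monomialL2 n = fourierBasis n := by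
  rw [coe_fourierBasis]
  apply Lp.ext
  exact (coeFn_monomial n).trans (coeFn_fourierLp 2 n).symm

theorem inner_monomialL2 (n : ℤ) (f : Lp ℂ 2 circleMeasure) :
    inner ℂ (monomialL2 n) f = fourierCoeff f n := by
  rw [monomialL2_eq, ← HilbertBasis.repr_apply_apply, fourierBasis_repr]

/-- The coefficients of a product are the convolution of the coefficients (Parseval), and all terms
of the convolution vanish at negative indices. -/
theorem IsAnalytic.mul {f g : CircleFun} (hf : IsAnalytic f) (hg : IsAnalytic g)
    (hf1 : IsUnimodular f) (hg1 : IsUnimodular g) : IsAnalytic (f * g) := by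
  intro n hn
  let F : Lp ℂ 2 circleMeasure := ⟨monomial n * star f,
    ((isUnimodular_monomial n).mul hf1.star).mem_Lp⟩
  let G : Lp ℂ 2 circleMeasure := ⟨g, hg1.mem_Lp⟩
  have h1 : inner ℂ F G = fourierCoeff (f * g : CircleFun) n := by
    rw [inner_eq_fourierCoeff]
    change fourierCoeff (star (monomial n * star f) * g : CircleFun) 0 = _
    rw [star_mul_eq, star_monomial, star_star, mul_assoc, fourierCoeff_monomial_mul]
    simp
  rw [← h1, ← fourierBasis.tsum_inner_mul_inner F G]
  have h2 : ∀ k, inner ℂ F (fourierBasis k) = fourierCoeff f (n - k) := fun k => by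
    rw [← monomialL2_eq, inner_eq_fourierCoeff]
    change fourierCoeff (star (monomial n * star f) * monomial k : CircleFun) 0 = _
    rw [star_mul_eq, star_monomial, star_star, mul_assoc, mul_comm f, fourierCoeff_monomial_mul,
      fourierCoeff_monomial_mul]
    simp
  have h3 : ∀ k, inner ℂ (fourierBasis k) G = fourierCoeff g k := fun k => by
    rw [← monomialL2_eq, inner_monomialL2]
  have h4 : ∀ k, fourierCoeff f (n - k) * fourierCoeff g k = 0 := fun k => by
    rcases lt_or_ge k 0 with hk | hk
    · rw [hg k hk, mul_zero]
    · rw [hf (n - k) (by lia), zero_mul]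
  simp only [h2, h3, h4, tsum_zero]

end CircleFun

open CircleFun

namespace IsInner

variable {f g : CircleFun}

theorem isUnimodular (hf : IsInner f) : IsUnimodular f := hf.2

theorem isAnalytic (hf : IsInner f) : IsAnalytic f := hf.1.2

theorem mul (hf : IsInner f) (hg : IsInner g) : IsInner (f * g) :=
  isInner_iff.2 ⟨hf.isUnimodular.mul hg.isUnimodular,
    hf.isAnalytic.mul hg.isAnalytic hf.isUnimodular hg.isUnimodular⟩

theorem sharp (hf : IsInner f) : IsInner f.sharp :=
  isInner_iff.2 ⟨hf.isUnimodular.sharp, fun n hn => by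
    rw [fourierCoeff_sharp, hf.isAnalytic n hn, map_zero]⟩

theorem const_smul (hf : IsInner f) {c : ℂ} (hc : ‖c‖ = 1) : IsInner (c • f) := by
  refine isInner_iff.2 ⟨?_, fun n hn => ?_⟩
  · filter_upwards [hf.isUnimodular, AEEqFun.coeFn_smul c f] with t h1 h2
    simp [h1, h2, hc]
  · rw [fourierCoeff_congr_ae (AEEqFun.coeFn_smul c f), fourierCoeff.const_smul,
      hf.isAnalytic n hn, smul_zero]

end IsInner

namespace CircleFun

theorem eq_of_fourierCoeff_eq {f g : CircleFun} (hf : f ∈ Lp ℂ 2 circleMeasure)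
    (hg : g ∈ Lp ℂ 2 circleMeasure) (h : ∀ n, fourierCoeff f n = fourierCoeff g n) : f = g := by
  have : (⟨f, hf⟩ : Lp ℂ 2 circleMeasure) = ⟨g, hg⟩ := by
    apply fourierBasis.repr.injective
    ext n
    rw [fourierBasis_repr, fourierBasis_repr]
    exact h n
  exact congrArg Subtype.val this

/-- An inner function whose complex conjugate is also inner is constant. -/
theorem eq_smul_one_of_isInner_star {f : CircleFun} (hf : IsInner f) (hf' : IsInner (star f)) :
    ∃ c : ℂ, ‖c‖ = 1 ∧ f = c • (1 : CircleFun) := by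
  have hmem : (1 : CircleFun) ∈ Lp ℂ 2 circleMeasure := by
    rw [← monomial_zero]
    exact (isUnimodular_monomial 0).mem_Lp
  have hfc : f = fourierCoeff f 0 • (1 : CircleFun) := by
    refine eq_of_fourierCoeff_eq hf.isUnimodular.mem_Lp
      (Lp.const_smul_mem_Lp _ ⟨1, hmem⟩) fun n => ?_
    rw [fourierCoeff_congr_ae (AEEqFun.coeFn_smul _ _), fourierCoeff.const_smul, ← monomial_zero,
      fourierCoeff_congr_ae (coeFn_monomial 0), fourierCoeff_fourier]
    rcases lt_trichotomy n 0 with hn | rfl | hn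
    · simp [hf.isAnalytic n hn, hn.ne]
    · simp
    · have := hf'.isAnalytic (-n) (by lia)
      rw [fourierCoeff_star, neg_neg, map_eq_zero] at this
      simp [this, hn.ne']
  refine ⟨fourierCoeff f 0, ?_, hfc⟩
  obtain ⟨t, h1, h2, h3⟩ := (hf.isUnimodular.and ((AEEqFun.coeFn_smul (fourierCoeff f 0)
    (1 : CircleFun)).and (AEEqFun.coeFn_one (α := UnitAddCircle) (μ := circleMeasure)
      (β := ℂ)))).exists
  rw [← hfc] at h2
  rw [h2] at h1
  simpa [h3] using h1

/-! ### Greatest common divisors of inner functions -/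

/-- A function of norm `1` in `L²` for which all Fourier coefficients of `|u|²` of nonzero index
vanish is unimodular. The finite measures `|u|² dm` and `dm` agree on trigonometric polynomials,
which form a point-separating star subalgebra, hence they are equal. -/
theorem isUnimodular_of_fourierCoeff_star_mul_self (u : Lp ℂ 2 circleMeasure) (hu : ‖u‖ = 1)
    (h : ∀ n : ℤ, n ≠ 0 → fourierCoeff (star (u : CircleFun) * (u : CircleFun) : CircleFun) n = 0) :
    IsUnimodular u := by
  have hmeas : Measurable fun t => ‖(u : CircleFun) t‖₊ ^ 2 :=
    (u : CircleFun).measurable.nnnorm.pow_const 2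
  have hfin : ∫⁻ t, ((‖(u : CircleFun) t‖₊ ^ 2 : NNReal) : ℝ≥0∞) ∂circleMeasure ≠ ∞ := by
    have := (Lp.memLp u).eLpNorm_lt_top
    rw [eLpNorm_lt_top_iff_lintegral_rpow_enorm_lt_top (by simp) (by simp)] at this
    simpa [enorm] using this.ne
  set ν := circleMeasure.withDensity
    fun t => ((‖(u : CircleFun) t‖₊ ^ 2 : NNReal) : ℝ≥0∞) with hν
  have : IsFiniteMeasure ν := isFiniteMeasure_withDensity hfin
  have hint : ∀ (ρ : Measure UnitAddCircle) [IsFiniteMeasure ρ] (f : C(UnitAddCircle, ℂ)),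
      Integrable f ρ := fun ρ _ f => (BoundedContinuousFunction.mkOfCompact f).integrable ρ
  have hfourier : ∀ n : ℤ, ∫ t, fourier n t ∂ν = ∫ t, fourier n t ∂circleMeasure := by
    intro n
    have h1 : ∫ t, fourier n t ∂ν =
        fourierCoeff (star (u : CircleFun) * (u : CircleFun) : CircleFun) (-n) := by
      rw [hν, integral_withDensity_eq_integral_smul hmeas]
      apply integral_congr_ae
      filter_upwards [AEEqFun.coeFn_mul (star (u : CircleFun)) u,
        AEEqFun.coeFn_star (u : CircleFun)] with t h1 h2
      rw [h1, Pi.mul_apply, h2, neg_neg, Pi.star_apply, RCLike.star_def, Complex.conj_mul',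
        NNReal.smul_def]
      simp [mul_comm]
    have h2 : ∫ t, fourier n t ∂circleMeasure = if n = 0 then 1 else 0 := by
      have := fourierCoeff_fourier (T := 1) n
      have := congrFun this 0
      simpa [fourierCoeff, Pi.single_apply, eq_comm] using this
    rw [h1, h2]
    split_ifs with hn
    · subst hn
      rw [neg_zero, ← inner_eq_fourierCoeff, inner_self_eq_norm_sq_to_K, hu]
      simp
    · exact h _ (by simpa using hn)
  have hspan : ∀ f ∈ Submodule.span ℂ (Set.range (@fourier 1)),
      ∫ t, f t ∂ν = ∫ t, f t ∂circleMeasure := by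
    intro f hf
    induction hf using Submodule.span_induction with
    | mem f hf => obtain ⟨n, rfl⟩ := hf; exact hfourier n
    | zero => simp
    | add f g _ _ hf hg =>
      simp only [ContinuousMap.add_apply]
      rw [integral_add (hint _ _) (hint _ _), integral_add (hint _ _) (hint _ _), hf, hg]
    | smul c f _ hf =>
      simp only [ContinuousMap.smul_apply]
      rw [integral_smul, integral_smul, hf]
  have hνm : ν = circleMeasure := by
    let φ := BoundedContinuousFunction.toContinuousMapStarₐ (α := UnitAddCircle) (β := ℂ) ℂ
    refine ext_of_forall_mem_subalgebra_integral_eq_of_pseudoEMetric_complete_countable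
      (A := (fourierSubalgebra (T := 1)).comap φ) ?_ fun g hg => ?_
    · intro x y hxy
      obtain ⟨_, ⟨f, hf, rfl⟩, hfxy⟩ := fourierSubalgebra_separatesPoints (T := 1) hxy
      exact ⟨_, ⟨f, ⟨BoundedContinuousFunction.mkOfCompact f, hf, rfl⟩, rfl⟩, hfxy⟩
    · refine hspan (φ g) ?_
      rw [← fourierSubalgebra_coe]
      exact hg
  have hone := (withDensity_eq_iff hmeas.coe_nnreal_ennreal.aemeasurable aemeasurable_one hfin).1
    (hνm.trans withDensity_one.symm)
  filter_upwards [hone] with t ht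
  have ht' : ‖(u : CircleFun) t‖₊ ^ 2 = 1 := by exact_mod_cast ht
  have h1 : ‖(u : CircleFun) t‖₊ = 1 := by
    rcases pow_eq_one_iff.1 ht' with h1 | h1
    · exact h1
    · simp at h1
  exact congrArg NNReal.toReal h1

/-- **Greatest common divisors of inner functions.** The function `u` is an inner divisor of `α`
and `β`, and any unimodular `ψ` that multiplies `α` and `β` into analytic functions does so with
`u`. It is the extremal function of the closed shift-invariant subspace `M` of `H²` generated by `α`
and `β`: the normalized projection onto `M` of `z ^ k`, where `k` is the least index at which
some element of `M` has a nonzero Fourier coefficient. As `⟨u, f⟩` is a multiple of the `k`-th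
coefficient of `f` for `f ∈ M`, `u` is orthogonal to `z M`. This makes `|u|²` constant and makes
`α / u` and `β / u` analytic. That `ψ * f` is analytic is a closed linear condition on `f`, stable
under multiplication by `z`, so it passes from `α` and `β` to `u ∈ M`. -/
theorem exists_isInner_gcd {α β : CircleFun} (hα : IsInner α) (hβ : IsInner β) :
    ∃ u : CircleFun, IsInner u ∧ IsInner (star u * α) ∧ IsInner (star u * β) ∧
      ∀ ψ : CircleFun, IsUnimodular ψ → IsAnalytic (ψ * α) → IsAnalytic (ψ * β) →
        IsAnalytic (ψ * u) := by
  let G : Set (Lp ℂ 2 circleMeasure) := {g | ∃ n : ℕ, ∃ f ∈ ({α, β} : Set CircleFun),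
    (g : CircleFun) = monomial n * f}
  have hinner : ∀ f ∈ ({α, β} : Set CircleFun), IsInner f := by
    rintro f (rfl | rfl) <;> assumption
  let M := (Submodule.span ℂ G).topologicalClosure
  have hGM : G ⊆ M := Submodule.subset_span.trans (Submodule.le_topologicalClosure _)
  have hM : ∀ c : Lp ℂ 2 circleMeasure, (∀ g ∈ G, inner ℂ c g = 0) → ∀ f ∈ M, inner ℂ c f = 0 := by
    intro c hc f hf
    have hle : M ≤ (Submodule.span ℂ {c})ᗮ := by
      refine Submodule.topologicalClosure_minimal _ ?_ (Submodule.isClosed_orthogonal _)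
      refine Submodule.span_le.2 fun g hg => ?_
      exact Submodule.mem_orthogonal_singleton_iff_inner_right.2 (hc g hg)
    exact Submodule.mem_orthogonal_singleton_iff_inner_right.1 (hle hf)
  -- the least index of a nonzero coefficient
  obtain ⟨k, hk0, hk⟩ : ∃ k : ℤ, (∃ f ∈ ({α, β} : Set CircleFun), fourierCoeff f k ≠ 0) ∧
      ∀ j < k, ∀ f ∈ ({α, β} : Set CircleFun), fourierCoeff f j = 0 := by
    have hne : ∃ n : ℕ, ∃ f ∈ ({α, β} : Set CircleFun), fourierCoeff f n ≠ 0 := by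
      by_contra! hzero
      have hα0 : α = 0 := by
        refine eq_of_fourierCoeff_eq hα.isUnimodular.mem_Lp (Lp ℂ 2 circleMeasure).zero_mem
          fun n => ?_
        have h0 : fourierCoeff ((0 : CircleFun) : UnitAddCircle → ℂ) n = 0 := by
          rw [fourierCoeff_congr_ae (AEEqFun.coeFn_zero (α := UnitAddCircle) (μ := circleMeasure)
            (β := ℂ))]
          simp [fourierCoeff]
        rw [h0]
        rcases lt_or_ge n 0 with hn | hn
        · exact hα.isAnalytic n hn
        · lift n to ℕ using hn
          exact hzero n α (by simp)
      obtain ⟨t, h1, h2⟩ := (hα.isUnimodular.and (AEEqFun.coeFn_zero (α := UnitAddCircle)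
        (μ := circleMeasure) (β := ℂ))).exists
      rw [hα0, h2] at h1
      simp at h1
    classical
    refine ⟨Nat.find hne, Nat.find_spec hne, fun j hj f hf => ?_⟩
    rcases lt_or_ge j 0 with hn | hn
    · exact (hinner f hf).isAnalytic j hn
    · lift j to ℕ using hn
      by_contra hcon
      exact Nat.find_min hne (by exact_mod_cast hj) ⟨f, hf, hcon⟩
  have : CompleteSpace M := (Submodule.isClosed_topologicalClosure _).completeSpace_coe
  -- `u₀` represents the functional `f ↦ fourierCoeff f k` on `M`
  obtain ⟨u₀, hu₀M, hu₀⟩ : ∃ u₀ ∈ M, ∀ f ∈ M, inner ℂ u₀ f = fourierCoeff f k := by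
    refine ⟨M.starProjection (monomialL2 k), M.starProjection_apply_mem _, fun f hf => ?_⟩
    rw [M.inner_starProjection_left_eq_right, Submodule.starProjection_eq_self_iff.2 hf,
      inner_monomialL2]
  have hu₀0 : u₀ ≠ 0 := by
    rintro rfl
    obtain ⟨f, hf, hfk⟩ := hk0
    have := hu₀ ⟨f, (hinner f hf).isUnimodular.mem_Lp⟩ (hGM ⟨0, f, hf, ?_⟩)
    · exact hfk (by simpa using this.symm)
    · simp [monomial_zero]
  have hr : (‖u₀‖ : ℂ) ≠ 0 := by simpa using hu₀0
  obtain ⟨u, huM, hu1, hu⟩ : ∃ u ∈ M, ‖u‖ = 1 ∧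
      ∀ f ∈ M, fourierCoeff f k = 0 → inner ℂ u f = 0 := by
    refine ⟨(‖u₀‖ : ℂ)⁻¹ • u₀, M.smul_mem _ hu₀M, ?_, fun f hf hfk => ?_⟩
    · rw [norm_smul, norm_inv, Complex.norm_real, norm_norm, inv_mul_cancel₀]
      simpa using hu₀0
    · rw [inner_smul_left, hu₀ f hf, hfk, mul_zero]
  -- `u` is orthogonal to `z ^ j * f` for `j ≥ 1`
  have horth : ∀ j : ℕ, 0 < j → ∀ f ∈ ({α, β} : Set CircleFun), ∀ n : ℕ,
      fourierCoeff (star (u : CircleFun) * (monomial (j + n) * f) : CircleFun) 0 = 0 := by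
    intro j hj f hf n
    have hmem : monomial (j + n) * f ∈ Lp ℂ 2 circleMeasure :=
      ((isUnimodular_monomial _).mul (hinner f hf).isUnimodular).mem_Lp
    have := hu ⟨_, hmem⟩ (hGM ⟨j + n, f, hf, by simp⟩) (by
      change fourierCoeff (monomial (j + n) * f : CircleFun) k = 0
      rw [fourierCoeff_monomial_mul]
      exact hk _ (by lia) f hf)
    rwa [inner_eq_fourierCoeff] at this
  have huneg : ∀ j : ℕ, 0 < j →
      fourierCoeff (star (u : CircleFun) * (u : CircleFun) : CircleFun) (-j) = 0 := by
    intro j hj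
    let c : Lp ℂ 2 circleMeasure :=
      ⟨monomial (-j) * u, (isUnimodular_monomial _).mul_mem_Lp u.2⟩
    have hc : ∀ g : Lp ℂ 2 circleMeasure, inner ℂ c g =
        fourierCoeff (monomial j * (star (u : CircleFun) * (g : CircleFun)) : CircleFun) 0 := by
      intro g
      rw [inner_eq_fourierCoeff]
      change fourierCoeff (star (monomial (-j) * (u : CircleFun)) * (g : CircleFun)) 0 = _
      rw [star_mul_eq, star_monomial, neg_neg, mul_assoc]
    have := hM c (fun g ⟨n, f, hf, hg⟩ => by
      rw [hc, hg, mul_left_comm, ← mul_assoc (monomial j), monomial_mul_monomial]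
      exact horth j hj f hf n) u huM
    rwa [hc, fourierCoeff_monomial_mul, zero_sub] at this
  have huU : IsUnimodular u := by
    refine isUnimodular_of_fourierCoeff_star_mul_self u hu1 fun n hn => ?_
    rcases lt_or_gt_of_ne hn with hn | hn
    · obtain ⟨j, rfl⟩ := Int.exists_eq_neg_ofNat hn.le
      exact huneg j (by lia)
    · lift n to ℕ using hn.le
      have := fourierCoeff_star (star (u : CircleFun) * (u : CircleFun)) n
      rwa [star_mul_eq, star_star, mul_comm, huneg n (by lia), map_zero] at this
  have hdiv : ∀ f ∈ ({α, β} : Set CircleFun), IsInner (star (u : CircleFun) * f) := by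
    intro f hf
    refine isInner_iff.2 ⟨huU.star.mul (hinner f hf).isUnimodular, fun n hn => ?_⟩
    obtain ⟨j, rfl⟩ := Int.exists_eq_neg_ofNat hn.le
    have := horth j (by lia) f hf 0
    rw [mul_left_comm, fourierCoeff_monomial_mul] at this
    simpa using this
  have hψ : ∀ ψ : CircleFun, IsUnimodular ψ → IsAnalytic (ψ * α) → IsAnalytic (ψ * β) →
      IsAnalytic (ψ * u) := by
    intro ψ hψ1 hψα hψβ n hn
    have hψf : ∀ f ∈ ({α, β} : Set CircleFun), IsAnalytic (ψ * f) := by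
      rintro f (rfl | rfl) <;> assumption
    let c : Lp ℂ 2 circleMeasure :=
      ⟨monomial n * star ψ, ((isUnimodular_monomial _).mul hψ1.star).mem_Lp⟩
    have hc : ∀ g : Lp ℂ 2 circleMeasure, inner ℂ c g =
        fourierCoeff (ψ * (g : CircleFun) : CircleFun) n := by
      intro g
      rw [inner_eq_fourierCoeff]
      change fourierCoeff (star (monomial n * star ψ) * (g : CircleFun)) 0 = _
      rw [star_mul_eq, star_monomial, star_star, mul_assoc, fourierCoeff_monomial_mul]
      simp
    rw [← hc]
    refine hM c (fun g ⟨m, f, hf, hg⟩ => ?_) u huM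
    rw [hc, hg, mul_left_comm, fourierCoeff_monomial_mul]
    exact hψf f hf _ (by lia)
  refine ⟨u, isInner_iff.2 ⟨huU, ?_⟩, hdiv α (by simp), hdiv β (by simp), hψ⟩
  have hone : IsUnimodular (1 : CircleFun) := by
    rw [← monomial_zero]
    exact isUnimodular_monomial 0
  simpa using hψ 1 hone (by simpa using hα.isAnalytic) (by simpa using hβ.isAnalytic)

end CircleFun

/-! ### The equation `α α^# = β β^#` -/

theorem lemma5p3 (α : CircleFun) (hα : IsInner α)
    (hα_nonconst : ¬ ∃ c : ℂ, α = AEEqFun.const UnitAddCircle c) :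
    {β : CircleFun | IsInner β ∧ α * α.sharp = β * β.sharp} =
      {β : CircleFun | ∃ (u v : CircleFun) (c : ℂ),
        IsInner u ∧ IsInner v ∧ α = u * v ∧ ‖c‖ = 1 ∧ β = c • (u * v.sharp)} := by
  ext β
  constructor
  · rintro ⟨hβ, hαβ⟩
    -- `u` is the greatest common divisor, `v` and `w` are the coprime cofactors of `α` and `β`
    obtain ⟨u, hu, hv, hw, hgcd⟩ := exists_isInner_gcd hα hβ
    have huu := hu.isUnimodular.mul_star_self
    have hα_eq : α = u * (star u * α) := by rw [← mul_assoc, huu, one_mul]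
    have hβ_eq : β = u * (star u * β) := by rw [← mul_assoc, huu, one_mul]
    generalize star u * α = v at hv hα_eq
    generalize star u * β = w at hw hβ_eq
    have hvw : v * v.sharp = w * w.sharp := by
      have hu1 := (hu.isUnimodular.mul hu.isUnimodular.sharp).mul_star_self
      have h : (u * u.sharp) * (v * v.sharp) = (u * u.sharp) * (w * w.sharp) := by
        rw [hα_eq, hβ_eq, sharp_mul, sharp_mul] at hαβ
        rw [mul_mul_mul_comm, hαβ, mul_mul_mul_comm]
      rw [mul_comm] at hu1
      have h' := congrArg (star (u * u.sharp) * ·) h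
      simpa only [← mul_assoc _ (u * u.sharp), hu1, one_mul] using h'
    -- Euclid's lemma: applied to `ψ = y^# * star x * star u`, the defining property of the gcd `u`
    -- shows that `x` divides `y^#`
    have key : ∀ {x y : CircleFun}, IsInner x → IsInner y → x * x.sharp = y * y.sharp →
        IsAnalytic (y.sharp * star x * star u * (u * x)) ∧
        IsAnalytic (y.sharp * star x * star u * (u * y)) := by
      intro x y hx hy hxy
      have hxx := hx.isUnimodular.mul_star_self
      have e1 : y.sharp * star x * star u * (u * x) = y.sharp := by
        calc _ = y.sharp * (x * star x) * (u * star u) := by ac_rfl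
          _ = _ := by rw [hxx, huu, mul_one, mul_one]
      have e2 : y.sharp * star x * star u * (u * y) = x.sharp := by
        calc _ = (y * y.sharp) * star x * (u * star u) := by ac_rfl
          _ = x.sharp * (x * star x) * (u * star u) := by rw [← hxy]; ac_rfl
          _ = _ := by rw [hxx, huu, mul_one, mul_one]
      rw [e1, e2]
      exact ⟨hy.sharp.isAnalytic, hx.sharp.isAnalytic⟩
    have hcancel : ∀ x : CircleFun, x * star u * u = x := fun x => by
      rw [mul_assoc, mul_comm (star u), huu, mul_one]
    have hs : IsInner (w.sharp * star v) := by
      have hU := hw.sharp.isUnimodular.mul hv.isUnimodular.star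
      refine isInner_iff.2 ⟨hU, ?_⟩
      obtain ⟨h1, h2⟩ := key hv hw hvw
      rw [← hα_eq] at h1
      rw [← hβ_eq] at h2
      simpa only [hcancel] using hgcd _ (hU.mul hu.isUnimodular.star) h1 h2
    have hr : IsInner (v.sharp * star w) := by
      have hU := hv.sharp.isUnimodular.mul hw.isUnimodular.star
      refine isInner_iff.2 ⟨hU, ?_⟩
      obtain ⟨h1, h2⟩ := key hw hv hvw.symm
      rw [← hα_eq] at h2
      rw [← hβ_eq] at h1
      simpa only [hcancel] using hgcd _ (hU.mul hu.isUnimodular.star) h2 h1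
    -- `v^# / w` is the image of `v / w^#` under `#`, so `w^# / v` and its inverse are both inner
    have hs' : IsInner (star (w.sharp * star v)) := by
      have := hr.sharp
      rwa [sharp_mul, sharp_sharp, sharp_star, mul_comm, ← star_star v, ← star_mul_eq] at this
    obtain ⟨c, hc, hsc⟩ := eq_smul_one_of_isInner_star hs hs'
    have hwv : w.sharp = c • v := by
      calc w.sharp = w.sharp * (v * star v) := by rw [hv.isUnimodular.mul_star_self, mul_one]
        _ = v * (w.sharp * star v) := by ac_rfl
        _ = c • v := by rw [hsc, mul_smul_eq, mul_one]
    refine ⟨u, v, conj c, hu, hv, hα_eq, by simpa using hc, ?_⟩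
    rw [hβ_eq, ← sharp_sharp w, hwv, sharp_smul, mul_smul_eq]
  · rintro ⟨u, v, c, hu, hv, rfl, hc, rfl⟩
    refine ⟨(hu.mul hv.sharp).const_smul hc, ?_⟩
    rw [sharp_smul, sharp_mul, sharp_mul, sharp_sharp, smul_mul_eq, mul_smul_eq, smul_smul,
      Complex.mul_conj,
      Complex.normSq_eq_norm_sq, hc]
    simp only [one_pow, Complex.ofReal_one, one_smul]
    ac_rfl
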